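/- Let $P(X)=a_dX^d+\dots+a_0\in\mathbb Z[X]$ with $d\ge 1$, $a_d\ge 1$, $\gcd(a_d,\dots,a_0)=1$ and $a_0\neq 0$. Assume that $P$ has no multiple roots in $\mathbb C$ and that every irreducible factor of $P$ in $\mathbb Z[X]$ has at least one complex root of modulus greater than $1$. Let $\alpha_1,\dots,\alpha_p$ be the distinct complex roots of $P$ of modulus greater than $1$. For an integer $k\ge 0$ let $\Xi_k$ be the set of all tuples $g=(g_1,\dots,g_p)$ of polynomials in $\mathbb C[X]$ of degree at most $k$ such that $g_j=\overline{g_i}$ (conjugate coefficients) whenever $\alpha_j=\overline{\alpha_i}$; in particular, $g_i\in\mathbb R[X]$ if $\alpha_i\in\mathbb R$. For $g\in\Xi_k$ and $n\in\mathbb Z$ put $$x_n(g)=\sum_{i=1}^p g_i(n)\,\alpha_i^{\,n}\in\mathbb R .$$ For $x\in\mathbb R$ let $\|x\|$ denote the distance from $x$ to the nearest integer, and set $$\mathcal L^{(k)}(P)=\Bigl\{\limsup_{n\to\infty}\|x_n(g)\| \;:\; g\in\Xi_k\Bigr\}.$$ If $P$ is monic and hyperbolic (that is, no complex root of $P$ has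 modulus $1$), then for every integer $k\ge 0$ the set $\mathcal L^{(k)}(P)$ is a closed subset of $[0,1/2]$. -/

import Mathlib

open Polynomial Filter ComplexConjugate

namespace MarkoffSpectrum

noncomputable section

/-- The standing assumptions on an integer polynomial: it has degree at least `1`, positive leading
coefficient, coprime coefficients, nonzero constant term, no multiple complex root, and each of its
irreducible factors in `ℤ[X]` has a complex root of modulus greater than `1`. -/
structure Admissible (P : ℤ[X]) : Prop where
  one_le_natDegree : 1 ≤ P.natDegree
  one_le_leadingCoeff : 1 ≤ P.leadingCoeff
  isPrimitive : P.IsPrimitive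
  coeff_zero_ne_zero : P.coeff 0 ≠ 0
  nodup_roots : (P.aroots ℂ).Nodup
  exists_expanding_root :
    ∀ Q : ℤ[X], Irreducible Q → Q ∣ P → ∃ α ∈ Q.aroots ℂ, 1 < ‖α‖

/-- No complex root of `P` has modulus `1`. -/
def Hyperbolic (P : ℤ[X]) : Prop :=
  ∀ α ∈ P.aroots ℂ, ‖α‖ ≠ 1

/-- The complex roots of `P` of modulus greater than `1`. -/
def expandingRoots (P : ℤ[X]) : Finset ℂ :=
  (P.aroots ℂ).toFinset.filter (fun α => 1 < ‖α‖)

/-- The set `Ξ_k`: families of complex polynomials of degree at most `k`, indexed by the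
expanding roots of `P`, such that the polynomial at the complex conjugate of a root has the
conjugate coefficients (for a real root this says that the coefficients are real). -/
def Xi (P : ℤ[X]) (k : ℕ) : Set (expandingRoots P → ℂ[X]) :=
  {g | (∀ i, (g i).natDegree ≤ k) ∧
    ∀ i j : expandingRoots P, (j : ℂ) = conj (i : ℂ) → g j = (g i).map (starRingEnd ℂ)}

/-- The sequence `x_n(g) = ∑ g_α(n) α ^ n`, the sum being over the expanding roots `α` of `P`. -/
def recSeqC (P : ℤ[X]) (g : expandingRoots P → ℂ[X]) (n : ℤ) : ℂ :=
  ∑ i : expandingRoots P, (g i).eval (n : ℂ) * (i : ℂ) ^ n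

/-- The same sequence as a real number; for `g ∈ Ξ_k` the sum is real, see `ofReal_recSeq`. -/
def recSeq (P : ℤ[X]) (g : expandingRoots P → ℂ[X]) (n : ℤ) : ℝ :=
  (recSeqC P g n).re

lemma conj_mem_expandingRoots {P : ℤ[X]} {α : ℂ} (h : α ∈ expandingRoots P) :
    conj α ∈ expandingRoots P := by
  simp only [expandingRoots, Finset.mem_filter, Multiset.mem_toFinset, mem_aroots,
    RCLike.norm_conj] at h ⊢
  refine ⟨⟨h.1.1, ?_⟩, h.2⟩
  have h2 := congrArg (starRingEnd ℂ) h.1.2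
  rw [map_zero, aeval_def, hom_eval₂] at h2
  rw [aeval_def, RingHom.ext_int (algebraMap ℤ ℂ) ((starRingEnd ℂ).comp (algebraMap ℤ ℂ))]
  exact h2

lemma ofReal_recSeq {P : ℤ[X]} {k : ℕ} {g : expandingRoots P → ℂ[X]} (hg : g ∈ Xi P k) (n : ℤ) :
    ((recSeq P g n : ℝ) : ℂ) = recSeqC P g n := by
  refine Complex.conj_eq_iff_re.mp ?_
  rw [recSeqC, map_sum]
  let e : expandingRoots P → expandingRoots P := fun i => ⟨conj i.1, conj_mem_expandingRoots i.2⟩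
  have he : Function.Involutive e := fun i => Subtype.ext (Complex.conj_conj _)
  refine Fintype.sum_bijective e he.bijective _ _ fun i => ?_
  have h1 : g (e i) = (g i).map (starRingEnd ℂ) := hg.2 i (e i) rfl
  have h2 : (n : ℂ) = conj (n : ℂ) := by simp
  rw [h1, map_mul, map_zpow₀]
  congr 1
  conv_rhs => rw [h2, eval_map, eval₂_hom]

/-- The distance from a real number to the nearest integer. -/
def distInt (x : ℝ) : ℝ := |x - round x|

/-- The spectrum `L^(k)(P)` of the values `limsup ‖x_n(g)‖` as `n → ∞`, for `g ∈ Ξ_k`. -/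
def lagrangeSpectrum (P : ℤ[X]) (k : ℕ) : Set ℝ :=
  {l | ∃ g ∈ Xi P k, l = limsup (fun n : ℤ => distInt (recSeq P g n)) atTop}

end

end MarkoffSpectrum

/-! Let `S` be the shift and `D = P ^ (k + 1)`. Since `D(S)` kills `x(g)`, it sends the rounding
errors of `x(g)` to a bounded integer sequence, the code, over a finite alphabet depending only on
`P` and `k`. Hyperbolicity makes `D(S)` robustly injective on bounded sequences
(`exists_window_multiset`): a long central word of the code determines the error at its centre up to
a small amount.

Given `l` in the closure of the spectrum, compactness provides one bi-infinite word `y` whose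
central words occur infinitely often, at times with error near `l`, in codes of points of the
spectrum tending to `l` (`exists_common_word_of_mem_closure`). Longer and longer pieces of these
codes, cut at such occurrences, are glued into one word `t` (`exists_glued_code`).

The word `t` is realised by `exists_mem_Xi_bounded_sub`: as `P` is monic, `D(S) u = t` has an
integer solution; as `P` is hyperbolic, it also has a bounded one. Their difference is a sum of
exponential polynomials; its contracting part stays bounded for `n ≥ 0`, and the real part of its
expanding part is `x(g)`. By the window property the errors of this `g` follow those of the glued
pieces, so its limsup is `l`. -/

namespace MarkoffSpectrum

noncomputable section

/-! ### Polynomials in the shift. -/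

/-- The shift `f ↦ (n ↦ f (n + 1))` on two-sided complex sequences. -/
def shiftEnd : Module.End ℂ (ℤ → ℂ) := LinearMap.funLeft ℂ ℂ (fun n : ℤ => n + 1)

lemma shiftEnd_apply (f : ℤ → ℂ) (n : ℤ) : shiftEnd f n = f (n + 1) := rfl

lemma shiftEnd_pow_apply (f : ℤ → ℂ) (i : ℕ) (n : ℤ) : (shiftEnd ^ i) f n = f (n + i) := by
  induction i generalizing n with
  | zero => simp
  | succ i ih =>
    rw [pow_succ', Module.End.mul_apply, shiftEnd_apply, ih]
    congr 1; push_cast; ring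

lemma aeval_shiftEnd_apply {D : ℤ[X]} {d : ℕ} (hd : D.natDegree < d) (f : ℤ → ℂ) (n : ℤ) :
    aeval shiftEnd D f n = ∑ i ∈ Finset.range d, (D.coeff i : ℂ) * f (n + i) := by
  rw [aeval_eq_sum_range' hd, LinearMap.sum_apply, Finset.sum_apply]
  refine Finset.sum_congr rfl fun i _ => ?_
  rw [LinearMap.smul_apply, Pi.smul_apply, shiftEnd_pow_apply, zsmul_eq_mul]

/-- Applying a polynomial in the shift commutes with translations. -/
lemma aeval_shiftEnd_translate (Q : ℂ[X]) (f : ℤ → ℂ) (a n : ℤ) :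
    aeval shiftEnd Q (fun m => f (m + a)) n = aeval shiftEnd Q f (n + a) := by
  rw [aeval_eq_sum_range, LinearMap.sum_apply, LinearMap.sum_apply, Finset.sum_apply,
    Finset.sum_apply]
  refine Finset.sum_congr rfl fun i _ => ?_
  simp only [LinearMap.smul_apply, Pi.smul_apply, shiftEnd_pow_apply]
  rw [add_right_comm]

lemma aeval_X_sub_C_apply (β : ℂ) (f : ℤ → ℂ) (n : ℤ) :
    aeval shiftEnd (X - C β) f n = f (n + 1) - β * f n := by
  simp [shiftEnd_apply, Module.algebraMap_end_apply]

/-! ### Hyperbolicity: approximate injectivity on windows. -/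

/-- The map `x ↦ c * x + (1 - c) * θ` fixes `θ`; this is its `R`-fold iterate. -/
lemma le_of_contracting_chain {c θ : ℝ} (hc : 0 ≤ c) {a : ℕ → ℝ} {R : ℕ}
    (h : ∀ r < R, a r ≤ c * a (r + 1) + (1 - c) * θ) :
    a 0 ≤ c ^ R * a R + (1 - c ^ R) * θ := by
  induction R with
  | zero => simp
  | succ R ih =>
    have h1 := ih fun r hr => h r (hr.trans (Nat.lt_succ_self R))
    have h2 := mul_le_mul_of_nonneg_left (h R (Nat.lt_succ_self R)) (pow_nonneg hc R)
    calc a 0 ≤ _ := h1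
      _ ≤ c ^ R * (c * a (R + 1) + (1 - c) * θ) + (1 - c ^ R) * θ := by linarith
      _ = _ := by ring

lemma exists_contracting_chain_small {c : ℝ} (hc : 0 ≤ c) (hc1 : c < 1) {B η : ℝ} (hη : 0 < η) :
    ∃ R : ℕ, ∀ a : ℕ → ℝ, a R ≤ B →
      (∀ r < R, a r ≤ c * a (r + 1) + (1 - c) * (η / 2)) → a 0 ≤ η := by
  have h : Tendsto (fun R : ℕ => c ^ R * B) atTop (nhds (0 * B)) :=
    (tendsto_pow_atTop_nhds_zero_of_lt_one hc hc1).mul_const B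
  rw [zero_mul] at h
  obtain ⟨R, hR⟩ := (h.eventually_lt_const (half_pos hη)).exists
  refine ⟨R, fun a ha hstep => ?_⟩
  have h1 := le_of_contracting_chain hc hstep
  have h2 := mul_le_mul_of_nonneg_left ha (pow_nonneg hc R)
  have h3 : 0 ≤ c ^ R * (η / 2) := by positivity
  linarith

/-- A sequence bounded on a long window and almost annihilated there by the shift minus `β`, with
`‖β‖ ≠ 1`, is small at the centre of the window. -/
lemma exists_window_X_sub_C {β : ℂ} (hβ : ‖β‖ ≠ 1) {B η : ℝ} (hη : 0 < η) :
    ∃ R : ℕ, ∃ θ : ℝ, 0 < θ ∧ ∀ f : ℤ → ℂ, (∀ m : ℤ, |m| ≤ R → ‖f m‖ ≤ B) →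
      (∀ m : ℤ, |m| ≤ R → ‖f (m + 1) - β * f m‖ ≤ θ) → ‖f 0‖ ≤ η := by
  rcases lt_or_gt_of_ne hβ with h | h
  · obtain ⟨R, hR⟩ := exists_contracting_chain_small (norm_nonneg β) h (B := B) hη
    -- For a contracting `β` the value at `0` is controlled from the past; this `θ` puts the fixed
    -- point of the chain at `η / 2`.
    refine ⟨R, (1 - ‖β‖) * (η / 2), by have := sub_pos.2 h; positivity, fun f hf hd => ?_⟩
    have := hR (fun r => ‖f (-r)‖) (hf _ (by simp)) fun r hr => ?_
    · simpa using this
    · have h1 := hd (-(r + 1 : ℕ)) (by rw [abs_neg, Nat.abs_cast]; exact_mod_cast hr)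
      have h2 : (-(r + 1 : ℕ) : ℤ) + 1 = -r := by push_cast; ring
      rw [h2] at h1
      have h3 := norm_le_norm_add_norm_sub' (f (-r)) (β * f (-(r + 1 : ℕ)))
      rw [norm_mul] at h3
      linarith
  · have hb : 0 < ‖β‖ := by linarith
    obtain ⟨R, hR⟩ := exists_contracting_chain_small (inv_nonneg.2 hb.le) (inv_lt_one_of_one_lt₀ h)
      (B := B) hη
    -- For an expanding `β` the control comes from the future, with ratio `‖β‖⁻¹`.
    refine ⟨R, (‖β‖ - 1) * (η / 2), by have := sub_pos.2 h; positivity, fun f hf hd => ?_⟩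
    have := hR (fun r => ‖f r‖) (hf _ (by simp)) fun r hr => ?_
    · simpa using this
    · have h1 := hd r (by rw [Nat.abs_cast]; exact_mod_cast hr.le)
      have h3 := norm_le_norm_add_norm_sub' (β * f r) (f (r + 1))
      rw [norm_mul, norm_sub_rev] at h3
      have h4 : (1 - ‖β‖⁻¹) * (η / 2) = ‖β‖⁻¹ * ((‖β‖ - 1) * (η / 2)) := by field_simp
      simp only [Nat.cast_add, Nat.cast_one]
      rw [h4, ← mul_add, le_inv_mul_iff₀ hb]
      linarith

/-- The window property for a polynomial in the shift without zeros on the unit circle. -/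
lemma exists_window_multiset (M : Multiset ℂ) (hM : ∀ β ∈ M, ‖β‖ ≠ 1) {B η : ℝ} (hη : 0 < η) :
    ∃ R : ℕ, ∃ θ : ℝ, 0 < θ ∧ ∀ f : ℤ → ℂ, (∀ m : ℤ, |m| ≤ R → ‖f m‖ ≤ B) →
      (∀ m : ℤ, |m| ≤ R → ‖aeval shiftEnd (M.map fun β => X - C β).prod f m‖ ≤ θ) →
        ‖f 0‖ ≤ η := by
  induction M using Multiset.induction_on generalizing B η with
  | empty => exact ⟨0, η, hη, fun f _ h => by simpa using h 0 (by simp)⟩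
  | cons β M ih =>
    obtain ⟨R₂, θ₂, hθ₂, h₂⟩ := exists_window_X_sub_C (hM β (Multiset.mem_cons_self β M)) (B := B) hη
    obtain ⟨R₁, θ₁, hθ₁, h₁⟩ := ih (fun γ hγ => hM γ (Multiset.mem_cons_of_mem hγ))
      (B := B + ‖β‖ * B) hθ₂
    -- Induction applies to the translates of `(S - β) f`; the extra `1` is there because `S - β`
    -- reads one term ahead.
    refine ⟨R₁ + R₂ + 1, θ₁, hθ₁, fun f hf hd => ?_⟩
    refine h₂ f (fun m hm => hf m (by push_cast; omega)) fun m hm => ?_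
    have h3 := h₁ (fun n => aeval shiftEnd (X - C β) f (n + m)) (fun n hn => ?_) (fun n hn => ?_)
    · simpa [shiftEnd_apply] using h3
    · rw [aeval_X_sub_C_apply]
      refine (norm_sub_le _ _).trans (add_le_add (hf _ ?_) ?_)
      · push_cast; rw [abs_le] at *; omega
      · rw [norm_mul]
        refine mul_le_mul_of_nonneg_left (hf _ ?_) (norm_nonneg _)
        push_cast; rw [abs_le] at *; omega
    · rw [aeval_shiftEnd_translate, ← Module.End.mul_apply, ← map_mul, mul_comm]
      have := hd (n + m) (by push_cast; rw [abs_le] at *; omega)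
      rwa [Multiset.map_cons, Multiset.prod_cons] at this

/-! ### Hyperbolicity: bounded solutions. -/

/-- A geometric series inverts `S - β`: over the past if `‖β‖ < 1`, over the future if `‖β‖ > 1`. -/
lemma exists_bounded_X_sub_C {β : ℂ} (hβ : ‖β‖ ≠ 1) {w : ℤ → ℂ} {B : ℝ} (hw : ∀ n, ‖w n‖ ≤ B) :
    ∃ y : ℤ → ℂ, (∃ B', ∀ n, ‖y n‖ ≤ B') ∧ aeval shiftEnd (X - C β) y = w := by
  have key : ∀ c : ℂ, ‖c‖ < 1 → ∀ v : ℕ → ℂ, (∀ i, ‖v i‖ ≤ B) →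
      Summable (fun i => c ^ i * v i) ∧ ‖∑' i, c ^ i * v i‖ ≤ (1 - ‖c‖)⁻¹ * B := by
    intro c hc v hv
    have hs : HasSum (fun i => ‖c‖ ^ i * B) ((1 - ‖c‖)⁻¹ * B) :=
      (hasSum_geometric_of_lt_one (norm_nonneg c) hc).mul_right B
    have hle : ∀ i, ‖c ^ i * v i‖ ≤ ‖c‖ ^ i * B := fun i => by
      rw [norm_mul, norm_pow]
      exact mul_le_mul_of_nonneg_left (hv i) (by positivity)
    exact ⟨Summable.of_norm_bounded hs.summable hle, tsum_of_norm_bounded hs hle⟩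
  rcases lt_or_gt_of_ne hβ with h | h
  · refine ⟨fun n => ∑' i : ℕ, β ^ i * w (n - 1 - i), ⟨_, fun n => (key β h _ fun i => hw _).2⟩, ?_⟩
    funext n
    rw [aeval_X_sub_C_apply, (key β h _ fun i => hw _).1.tsum_eq_zero_add, ← tsum_mul_left]
    have : ∀ i : ℕ, β ^ (i + 1) * w (n + 1 - 1 - (i + 1 : ℕ)) = β * (β ^ i * w (n - 1 - i)) := by
      intro i
      rw [pow_succ', mul_assoc]
      congr 3; push_cast; ring
    simp only [this]
    simp
  · have hb : β ≠ 0 := by rintro rfl; simp at h; linarith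
    have hc : ‖β⁻¹‖ < 1 := by rw [norm_inv]; exact inv_lt_one_of_one_lt₀ h
    refine ⟨fun n => -β⁻¹ * ∑' i : ℕ, β⁻¹ ^ i * w (n + i),
      ⟨‖-β⁻¹‖ * ((1 - ‖β⁻¹‖)⁻¹ * B), fun n => ?_⟩, ?_⟩
    · rw [norm_mul]
      exact mul_le_mul_of_nonneg_left (key β⁻¹ hc _ fun i => hw _).2 (norm_nonneg _)
    funext n
    have h1 := (key β⁻¹ hc (fun i => w (n + i)) fun i => hw _).1.tsum_eq_zero_add
    have : ∀ i : ℕ, β⁻¹ ^ (i + 1) * w (n + (i + 1 : ℕ)) = β⁻¹ * (β⁻¹ ^ i * w (n + 1 + i)) := by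
      intro i
      rw [pow_succ', mul_assoc]
      congr 3; push_cast; ring
    simp only [this, tsum_mul_left] at h1
    rw [aeval_X_sub_C_apply, h1]
    field_simp
    simp

/-- A polynomial in the shift without zeros on the unit circle is onto on bounded sequences. -/
lemma exists_bounded_multiset (M : Multiset ℂ) (hM : ∀ β ∈ M, ‖β‖ ≠ 1) {w : ℤ → ℂ} {B : ℝ}
    (hw : ∀ n, ‖w n‖ ≤ B) :
    ∃ y : ℤ → ℂ, (∃ B', ∀ n, ‖y n‖ ≤ B') ∧
      aeval shiftEnd (M.map fun β => X - C β).prod y = w := by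
  induction M using Multiset.induction_on generalizing w B with
  | empty => exact ⟨w, ⟨B, hw⟩, by simp⟩
  | cons β M ih =>
    obtain ⟨y₁, ⟨B₁, hB₁⟩, h₁⟩ := exists_bounded_X_sub_C (hM β (Multiset.mem_cons_self β M)) hw
    obtain ⟨y, hy, h⟩ := ih (fun γ hγ => hM γ (Multiset.mem_cons_of_mem hγ)) hB₁
    exact ⟨y, hy, by rw [Multiset.map_cons, Multiset.prod_cons, map_mul, Module.End.mul_apply, h, h₁]⟩

/-! ### Kernels: exponential polynomials. -/

-- Conjugation by `β ^ n` turns `S - β` into `β` times the forward difference, so kernels of powers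
-- reduce to polynomial sequences.
open fwdDiff in
lemma aeval_X_sub_C_pow_apply {β : ℂ} (hβ : β ≠ 0) (m : ℕ) (z : ℤ → ℂ) (n : ℤ) :
    aeval shiftEnd ((X - C β) ^ m) z n =
      β ^ (n + m) * (Δ_[(1 : ℤ)])^[m] (fun j => β ^ (-j) * z j) n := by
  induction m generalizing n with
  | zero => simp [zpow_neg, mul_inv_cancel_left₀ (zpow_ne_zero n hβ)]
  | succ m ih =>
    rw [pow_succ', map_mul, Module.End.mul_apply, aeval_X_sub_C_apply, ih, ih,
      Function.iterate_succ_apply', fwdDiff]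
    have h1 : β ^ (n + 1 + m) = β ^ (n + m) * β := by
      rw [← zpow_add_one₀ hβ]; congr 1; ring
    have h2 : β ^ (n + (m + 1 : ℕ)) = β ^ (n + m) * β := by
      rw [← zpow_add_one₀ hβ]; congr 1; push_cast; ring
    rw [h1, h2]; ring

/-- A sequence whose `k + 1`-st difference vanishes is given by a polynomial of degree at most `k`
on the natural numbers. -/
lemma exists_polynomial_of_fwdDiff_iter_eq_zero {w : ℤ → ℂ} {k : ℕ}
    (hw : (fwdDiff (1 : ℤ))^[k + 1] w = 0) :
    ∃ g : ℂ[X], g.natDegree ≤ k ∧ ∀ n : ℕ, w n = g.eval (n : ℂ) := by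
  have hz : ∀ j, k < j → (fwdDiff (1 : ℤ))^[j] w 0 = 0 := by
    intro j hj
    obtain ⟨i, rfl⟩ := Nat.exists_eq_add_of_le hj
    rw [Nat.succ_eq_add_one, add_comm, Function.iterate_add_apply, hw]
    have h0 : fwdDiff (1 : ℤ) (0 : ℤ → ℂ) = 0 := fwdDiff_const (1 : ℤ) (0 : ℂ)
    exact congrFun (Function.iterate_fixed h0 i) 0
  refine ⟨∑ j ∈ Finset.range (k + 1),
    C ((fwdDiff (1 : ℤ))^[j] w 0 / (j.factorial : ℂ)) * descPochhammer ℂ j, ?_, fun n => ?_⟩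
  · refine natDegree_sum_le_of_forall_le _ _ fun j hj => (natDegree_C_mul_le _ _).trans ?_
    rw [descPochhammer_natDegree]
    exact Nat.lt_succ_iff.1 (Finset.mem_range.1 hj)
  · have h1 := shift_eq_sum_fwdDiff_iter (1 : ℤ) w n 0
    rw [zero_add, nsmul_one] at h1
    have hterm : ∀ j : ℕ, (C ((fwdDiff (1 : ℤ))^[j] w 0 / (j.factorial : ℂ)) *
        descPochhammer ℂ j).eval (n : ℂ) = n.choose j • (fwdDiff (1 : ℤ))^[j] w 0 := by
      intro j
      have : (j.factorial : ℂ) ≠ 0 := by exact_mod_cast j.factorial_ne_zero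
      rw [eval_mul, eval_C, descPochhammer_eval_eq_descFactorial,
        Nat.descFactorial_eq_factorial_mul_choose, nsmul_eq_mul]
      push_cast
      field_simp
    rw [h1, eval_finsetSum, Finset.sum_congr rfl fun j _ => hterm j]
    -- Both Newton sums are padded to a common range: binomials vanish for `j > n`, differences for
    -- `j > k`.
    have hL : ∑ j ∈ Finset.range (n + 1), n.choose j • (fwdDiff (1 : ℤ))^[j] w 0 =
        ∑ j ∈ Finset.range (n + 1 + (k + 1)), n.choose j • (fwdDiff (1 : ℤ))^[j] w 0 :=
      Finset.sum_subset (fun j hj => by simp at hj ⊢; omega) fun j _ hj => by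
        rw [Nat.choose_eq_zero_of_lt (by simp at hj; omega), zero_smul]
    have hR : ∑ j ∈ Finset.range (k + 1), n.choose j • (fwdDiff (1 : ℤ))^[j] w 0 =
        ∑ j ∈ Finset.range (n + 1 + (k + 1)), n.choose j • (fwdDiff (1 : ℤ))^[j] w 0 :=
      Finset.sum_subset (fun j hj => by simp at hj ⊢; omega) fun j _ hj => by
        rw [hz j (by simp at hj; omega), smul_zero]
    rw [hL, hR]

lemma exists_eval_mul_pow_of_mem_ker {β : ℂ} (hβ : β ≠ 0) {k : ℕ} {z : ℤ → ℂ}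
    (hz : aeval shiftEnd ((X - C β) ^ (k + 1)) z = 0) :
    ∃ g : ℂ[X], g.natDegree ≤ k ∧ ∀ n : ℕ, z n = g.eval (n : ℂ) * β ^ n := by
  obtain ⟨g, hg, h⟩ := exists_polynomial_of_fwdDiff_iter_eq_zero (k := k)
    (w := fun j => β ^ (-j) * z j) (by
      funext n
      have := congrFun hz n
      rw [aeval_X_sub_C_pow_apply hβ, Pi.zero_apply, mul_eq_zero] at this
      exact this.resolve_left (zpow_ne_zero _ hβ))
  refine ⟨g, hg, fun n => ?_⟩
  rw [← h n]
  simp only [zpow_neg, zpow_natCast]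
  field_simp

lemma aeval_X_sub_C_pow_eval_mul_zpow {β : ℂ} (hβ : β ≠ 0) {k : ℕ} {g : ℂ[X]}
    (hg : g.natDegree ≤ k) :
    aeval shiftEnd ((X - C β) ^ (k + 1)) (fun n : ℤ => g.eval (n : ℂ) * β ^ n) = 0 := by
  funext n
  rw [aeval_X_sub_C_pow_apply hβ]
  have h1 : (fun j : ℤ => β ^ (-j) * (g.eval (j : ℂ) * β ^ j)) = fun j : ℤ => g.eval (j : ℂ) := by
    funext j
    rw [zpow_neg]
    field_simp [zpow_ne_zero j hβ]
  have h2 := congrFun (fwdDiff_iter_eq_zero_of_degree_lt (Nat.lt_succ_iff.2 hg)) (n : ℂ)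
  rw [Nat.succ_eq_add_one, fwdDiff_iter_eq_sum_shift] at h2
  rw [h1, fwdDiff_iter_eq_sum_shift]
  simp only [Pi.zero_apply] at h2 ⊢
  rw [mul_eq_zero]
  right
  rw [← h2]
  refine Finset.sum_congr rfl fun i _ => ?_
  simp

/-- Powers of distinct linear factors are coprime, so the kernel of the product is the sum of the
kernels. -/
lemma exists_sum_ker_of_mem_ker_prod (S : Finset ℂ) (m : ℕ) {z : ℤ → ℂ}
    (hz : aeval shiftEnd (∏ β ∈ S, (X - C β) ^ m) z = 0) :
    ∃ w : ℂ → ℤ → ℂ, (∀ β, aeval shiftEnd ((X - C β) ^ m) (w β) = 0) ∧ z = ∑ β ∈ S, w β := by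
  induction S using Finset.induction_on generalizing z with
  | empty => exact ⟨0, by simp, by simpa using hz⟩
  | insert γ S hγ ih =>
    rw [Finset.prod_insert hγ] at hz
    have hcop : IsCoprime ((X - C γ) ^ m) (∏ β ∈ S, (X - C β) ^ m) :=
      IsCoprime.prod_right fun β hβ => IsCoprime.pow
        (pairwise_coprime_X_sub_C Function.injective_id (by rintro rfl; exact hγ hβ))
    have h1 : z ∈ LinearMap.ker (aeval shiftEnd ((X - C γ) ^ m * ∏ β ∈ S, (X - C β) ^ m)) := hz
    rw [← sup_ker_aeval_eq_ker_aeval_mul_of_coprime shiftEnd hcop, Submodule.mem_sup] at h1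
    obtain ⟨y, hy, y', hy', rfl⟩ := h1
    obtain ⟨w, hw, rfl⟩ := ih hy'
    refine ⟨Function.update w γ y, fun β => ?_, ?_⟩
    · rcases eq_or_ne β γ with rfl | h
      · simpa using hy
      · simpa [h] using hw β
    · rw [Finset.sum_insert hγ, Function.update_self]
      congr 1
      refine Finset.sum_congr rfl fun β hβ => ?_
      rw [Function.update_of_ne (by rintro rfl; exact hγ hβ)]

/-! ### Integer solutions of monic recurrences. -/

/-- The solution of a monic integer recurrence with the right-hand side `t`, started at zero. -/
def monicSolution (D : ℤ[X]) (t : ℤ → ℤ) : ℕ → ℤ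
  | n => t (n - D.natDegree) - ∑ i : Fin D.natDegree,
      -- The guard encodes that the solution is zero at negative indices and keeps the natural
      -- subtraction exact.
      if _h : D.natDegree ≤ n + i then D.coeff i * monicSolution D t (n + i - D.natDegree) else 0
  termination_by n => n
  decreasing_by have := i.2; omega

/-- Monic integer recurrences with a right-hand side supported on `n ≥ 0` have integer solutions. -/
lemma exists_int_solution {D : ℤ[X]} (hD : D.Monic) {t : ℤ → ℤ} (ht : ∀ n < 0, t n = 0) :
    ∃ u : ℤ → ℤ, ∀ n, ∑ i ∈ Finset.range (D.natDegree + 1), D.coeff i * u (n + i) = t n := by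
  refine ⟨fun n => if 0 ≤ n then monicSolution D t n.toNat else 0, fun n => ?_⟩
  rcases lt_or_ge (n + D.natDegree) 0 with h | h
  · rw [ht n (by omega)]
    refine Finset.sum_eq_zero fun i hi => ?_
    rw [Finset.mem_range] at hi
    beta_reduce
    rw [if_neg (by omega), mul_zero]
  · obtain ⟨N, hN⟩ := Int.eq_ofNat_of_zero_le h
    have hn : n = N - D.natDegree := by omega
    beta_reduce
    rw [Finset.sum_range_succ, hD.coeff_natDegree, one_mul, if_pos h, hN, Int.toNat_natCast,
      monicSolution, ← hn, Finset.sum_range]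
    have : ∀ i : Fin D.natDegree,
        (D.coeff i * if 0 ≤ n + (i : ℕ) then monicSolution D t (n + (i : ℕ)).toNat else 0) =
        if _h : D.natDegree ≤ N + i then
          D.coeff i * monicSolution D t (N + i - D.natDegree) else 0 := by
      intro i
      by_cases hi : D.natDegree ≤ N + i
      · rw [dif_pos hi, if_pos (by omega)]
        congr 2
        omega
      · rw [dif_neg hi, if_neg (by omega), mul_zero]
    rw [Finset.sum_congr rfl fun i _ => this i]
    ring

/-! ### Realising an integer word by some `x(g)`. -/

section roots

variable {P : ℤ[X]}

lemma Admissible.ne_zero_of_mem_aroots (hP : Admissible P) {β : ℂ} (hβ : β ∈ P.aroots ℂ) :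
    β ≠ 0 := by
  rintro rfl
  have h := (mem_aroots.1 hβ).2
  rw [aeval_def, eval₂_at_zero] at h
  exact hP.coeff_zero_ne_zero (by simpa using h)

lemma map_eq_prod_aroots (hmonic : P.Monic) :
    P.map (algebraMap ℤ ℂ) = ((P.aroots ℂ).map fun β => X - C β).prod :=
  (IsAlgClosed.splits _).eq_prod_roots_of_monic (hmonic.map _)

lemma aeval_pow_eq_aeval_multiset (hmonic : P.Monic) (k : ℕ) :
    aeval shiftEnd (P ^ k) =
      aeval shiftEnd ((k • P.aroots ℂ).map fun β => X - C β).prod := by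
  rw [Multiset.map_nsmul, Multiset.prod_nsmul, ← map_eq_prod_aroots hmonic, ← Polynomial.map_pow,
    aeval_map_algebraMap]

lemma aeval_pow_eq_aeval_finset (hP : Admissible P) (hmonic : P.Monic) (k : ℕ) :
    aeval shiftEnd (P ^ k) =
      aeval shiftEnd (∏ β ∈ (P.aroots ℂ).toFinset, (X - C β) ^ k) := by
  rw [aeval_pow_eq_aeval_multiset hmonic, Multiset.map_nsmul, Multiset.prod_nsmul,
    Finset.prod_pow, Finset.prod, Multiset.toFinset_val, hP.nodup_roots.dedup]

lemma mem_aroots_of_mem_expandingRoots {β : ℂ} (h : β ∈ expandingRoots P) : β ∈ P.aroots ℂ :=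
  Multiset.mem_toFinset.1 (Finset.mem_filter.1 h).1

/-- The sequences `x_n(g)` satisfy the recurrence with characteristic polynomial `P ^ (k + 1)`. -/
lemma aeval_pow_recSeqC (hP : Admissible P) (hmonic : P.Monic) {k : ℕ}
    {g : expandingRoots P → ℂ[X]} (hg : ∀ i, (g i).natDegree ≤ k) :
    aeval shiftEnd (P ^ (k + 1)) (recSeqC P g) = 0 := by
  have h : recSeqC P g = ∑ i, fun n : ℤ => (g i).eval (n : ℂ) * (i : ℂ) ^ n := by
    funext n; rw [recSeqC, Finset.sum_apply]
  rw [h, map_sum]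
  refine Finset.sum_eq_zero fun i _ => ?_
  have hi := mem_aroots_of_mem_expandingRoots i.2
  rw [aeval_pow_eq_aeval_finset hP hmonic, ← Finset.prod_erase_mul _ _ (Multiset.mem_toFinset.2 hi),
    map_mul, Module.End.mul_apply,
    aeval_X_sub_C_pow_eval_mul_zpow (hP.ne_zero_of_mem_aroots hi) (hg i), map_zero]

/-- The real part of a sum `∑ G_α(n) α ^ n` over the expanding roots is of the form `x_n(g)`. -/
lemma exists_mem_Xi_recSeq_eq {k : ℕ} {G : expandingRoots P → ℂ[X]}
    (hG : ∀ i, (G i).natDegree ≤ k) :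
    ∃ g ∈ Xi P k, ∀ n, recSeq P g n = (recSeqC P G n).re := by
  let e : expandingRoots P → expandingRoots P := fun i => ⟨conj i.1, conj_mem_expandingRoots i.2⟩
  have he : Function.Involutive e := fun i => Subtype.ext (Complex.conj_conj _)
  -- Averaging with the conjugate family gives the conjugation symmetry and the real part.
  refine ⟨fun i => C (1 / 2) * (G i + (G (e i)).map (starRingEnd ℂ)), ⟨fun i => ?_, ?_⟩, fun n => ?_⟩
  · exact (natDegree_C_mul_le _ _).trans
      (natDegree_add_le_of_degree_le (hG i) (natDegree_map_le.trans (hG _)))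
  · intro i j hij
    obtain rfl : j = e i := Subtype.ext hij
    beta_reduce
    rw [he i]
    simp [Polynomial.map_map, add_comm, Complex.conj_ofNat]
  · have h1 : ∑ i : expandingRoots P, ((G (e i)).map (starRingEnd ℂ)).eval (n : ℂ) * (i : ℂ) ^ n =
        conj (recSeqC P G n) := by
      rw [recSeqC, map_sum]
      refine Fintype.sum_bijective e he.bijective _ _ fun i => ?_
      have h2 : (n : ℂ) = conj (n : ℂ) := by simp
      rw [map_mul, map_zpow₀]
      conv_lhs => rw [h2, eval_map, eval₂_hom]
      simp [e]
    have h2 : recSeqC P (fun i => C (1 / 2) * (G i + (G (e i)).map (starRingEnd ℂ))) n =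
        1 / 2 * (recSeqC P G n + conj (recSeqC P G n)) := by
      rw [← h1, recSeqC, recSeqC, ← Finset.sum_add_distrib, Finset.mul_sum]
      refine Finset.sum_congr rfl fun i _ => ?_
      rw [eval_mul, eval_C, eval_add]; ring
    rw [recSeq, h2, Complex.add_conj]
    norm_num
    ring

lemma exists_bound_eval_mul_pow {β : ℂ} (hβ : ‖β‖ < 1) (g : ℂ[X]) :
    ∃ B : ℝ, ∀ n : ℕ, ‖g.eval (n : ℂ) * β ^ n‖ ≤ B := by
  have h : Tendsto (fun n : ℕ => ∑ j ∈ Finset.range (g.natDegree + 1),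
      ‖g.coeff j‖ * ((n : ℝ) ^ j * ‖β‖ ^ n)) atTop
      (nhds (∑ j ∈ Finset.range (g.natDegree + 1), ‖g.coeff j‖ * 0)) :=
    tendsto_finsetSum _ fun j _ =>
      (tendsto_pow_const_mul_const_pow_of_lt_one j (norm_nonneg β) hβ).const_mul _
  obtain ⟨B, hB⟩ := h.bddAbove_range
  refine ⟨B, fun n => le_trans ?_ (hB ⟨n, rfl⟩)⟩
  rw [eval_eq_sum_range, Finset.sum_mul]
  refine (norm_sum_le _ _).trans (Finset.sum_le_sum fun j _ => ?_)
  simp [mul_assoc]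

/-- Every bounded integer sequence supported on `n ≥ 0` is the image under `P ^ (k + 1)` of the
difference between an integer sequence and some `x(g)`, with bounded difference on `n ≥ 0`. -/
lemma exists_mem_Xi_bounded_sub (hP : Admissible P) (hmonic : P.Monic) (hhyp : Hyperbolic P)
    (k : ℕ) {t : ℤ → ℤ} (ht : ∀ n < 0, t n = 0) {B : ℤ} (hB : ∀ n, |t n| ≤ B) :
    ∃ g ∈ Xi P k, ∃ u : ℤ → ℤ, (∃ C : ℝ, ∀ n : ℕ, |u n - recSeq P g n| ≤ C) ∧
      aeval shiftEnd (P ^ (k + 1)) (fun n => ((u n - recSeq P g n : ℝ) : ℂ)) =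
        fun n => (t n : ℂ) := by
  obtain ⟨u, hu⟩ := exists_int_solution (hmonic.pow (k + 1)) ht
  have hu' : aeval shiftEnd (P ^ (k + 1)) (fun n => (u n : ℂ)) = fun n => (t n : ℂ) := by
    funext n
    rw [aeval_shiftEnd_apply (Nat.lt_succ_self _), ← hu n]
    push_cast; rfl
  obtain ⟨y, ⟨B', hB'⟩, hy⟩ := exists_bounded_multiset ((k + 1) • P.aroots ℂ)
    (fun β hβ => hhyp β (Multiset.mem_of_mem_nsmul hβ)) (w := fun n => (t n : ℂ)) (B := B)
    (fun n => by rw [Complex.norm_intCast]; exact_mod_cast hB n)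
  rw [← aeval_pow_eq_aeval_multiset hmonic] at hy
  have hz : aeval shiftEnd (P ^ (k + 1)) ((fun n => (u n : ℂ)) - y) = 0 := by
    rw [map_sub, hu', hy, sub_self]
  rw [aeval_pow_eq_aeval_finset hP hmonic] at hz
  obtain ⟨w, hw, hsum⟩ := exists_sum_ker_of_mem_ker_prod _ _ hz
  have hex : ∀ β : ℂ, ∃ G : ℂ[X], β ∈ P.aroots ℂ →
      G.natDegree ≤ k ∧ ∀ n : ℕ, w β n = G.eval (n : ℂ) * β ^ n := by
    intro β
    by_cases hβ : β ∈ P.aroots ℂ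
    · obtain ⟨G, hG⟩ := exists_eval_mul_pow_of_mem_ker (hP.ne_zero_of_mem_aroots hβ) (hw β)
      exact ⟨G, fun _ => hG⟩
    · exact ⟨0, fun h => absurd h hβ⟩
  choose G hG using hex
  obtain ⟨g, hg, hgre⟩ := exists_mem_Xi_recSeq_eq (k := k) (G := fun i : expandingRoots P => G i)
    fun i => (hG i (mem_aroots_of_mem_expandingRoots i.2)).1
  have hcontr : ∀ β : ℂ, ∃ B'' : ℝ, ‖β‖ < 1 → ∀ n : ℕ, ‖(G β).eval (n : ℂ) * β ^ n‖ ≤ B'' := by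
    intro β
    by_cases hβ : ‖β‖ < 1
    · obtain ⟨b, hb⟩ := exists_bound_eval_mul_pow hβ (G β)
      exact ⟨b, fun _ => hb⟩
    · exact ⟨0, fun h => absurd h hβ⟩
  choose b hb using hcontr
  -- On `n ≥ 0`, `u - x(g)` is the real part of the bounded solution plus the contracting terms;
  -- roots of modulus `1` are excluded.
  refine ⟨g, hg, u, ⟨B' + ∑ β ∈ (P.aroots ℂ).toFinset with ¬ 1 < ‖β‖, b β, fun n => ?_⟩, ?_⟩
  · have h1 := congrFun hsum n
    rw [Finset.sum_apply, Pi.sub_apply,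
      Finset.sum_congr rfl fun β hβ => (hG β (Multiset.mem_toFinset.1 hβ)).2 n,
      ← Finset.sum_filter_add_sum_filter_not _ (fun β => 1 < ‖β‖)] at h1
    have h2 : recSeqC P (fun i : expandingRoots P => G i) n =
        ∑ β ∈ (P.aroots ℂ).toFinset with 1 < ‖β‖, (G β).eval (n : ℂ) * β ^ n := by
      rw [recSeqC]
      simp only [zpow_natCast, Int.cast_natCast]
      exact Finset.sum_coe_sort (expandingRoots P) fun β => (G β).eval (n : ℂ) * β ^ n
    rw [← h2] at h1
    have h3 : (u n : ℝ) - recSeq P g n = (y n +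
        ∑ β ∈ (P.aroots ℂ).toFinset with ¬ 1 < ‖β‖, (G β).eval (n : ℂ) * β ^ n).re := by
      have h4 := congrArg Complex.re h1
      rw [hgre]
      simp only [Complex.sub_re, Complex.add_re, Complex.intCast_re] at h4 ⊢
      linarith
    rw [h3]
    refine (Complex.abs_re_le_norm _).trans ((norm_add_le _ _).trans (add_le_add (hB' n) ?_))
    refine (norm_sum_le _ _).trans (Finset.sum_le_sum fun β hβ => ?_)
    rw [Finset.mem_filter, Multiset.mem_toFinset, not_lt] at hβ
    exact hb β (lt_of_le_of_ne hβ.2 (hhyp β hβ.1)) n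
  · have h1 : (fun n => ((u n - recSeq P g n : ℝ) : ℂ)) = (fun n => (u n : ℂ)) - recSeqC P g := by
      funext n
      rw [Pi.sub_apply, ← ofReal_recSeq hg]; push_cast; rfl
    rw [h1, map_sub, aeval_pow_recSeqC hP hmonic hg.1, sub_zero, hu']

end roots

/-! ### Codes of rounding errors and compactness. -/

/-- The integer sequence `s` is the image of the real sequence `e` under the polynomial `D` in the
shift. -/
def IsCode (D : ℤ[X]) (e : ℤ → ℝ) (s : ℤ → ℤ) : Prop :=
  aeval shiftEnd D (fun n => (e n : ℂ)) = fun n => (s n : ℂ)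

lemma IsCode.translate {D : ℤ[X]} {e : ℤ → ℝ} {s : ℤ → ℤ} (h : IsCode D e s) (a : ℤ) :
    IsCode D (fun n => e (n + a)) (fun n => s (n + a)) := by
  funext n
  rw [← aeval_map_algebraMap ℂ, aeval_shiftEnd_translate _ (fun n => (e n : ℂ)),
    aeval_map_algebraMap, h]

/-- Along an ultrafilter, a family of uniformly bounded integer sequences converges pointwise. -/
lemma exists_ultrafilter_limit {ι : Type*} (U : Ultrafilter ι) {s : ι → ℤ → ℤ} {B : ℤ}
    (hB : ∀ i n, |s i n| ≤ B) :
    ∃ y : ℤ → ℤ, (∀ m, |y m| ≤ B) ∧ ∀ N : ℕ, ∀ᶠ i in U, ∀ m : ℤ, |m| ≤ N → s i m = y m := by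
  have h : ∀ m, ∃ a ∈ Set.Icc (-B) B, ∀ᶠ i in U, s i m = a := fun m =>
    (Ultrafilter.eventually_exists_mem_iff (Set.finite_Icc (-B) B)).1
      (Eventually.of_forall fun i => ⟨s i m, abs_le.1 (hB i m), rfl⟩)
  choose y hy hyU using h
  refine ⟨y, fun m => abs_le.2 (hy m), fun N => ?_⟩
  have := (eventually_all_finite (Set.finite_Icc (-(N : ℤ)) N)).2 fun m _ => hyU m
  exact this.mono fun i hi m hm => hi m (abs_le.1 hm)

/-- Compactness of the space of words over a finite alphabet, applied to the translates of `s` by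
the times satisfying `p`. -/
lemma exists_word_limit {s : ℤ → ℤ} {B : ℤ} (hB : ∀ n, |s n| ≤ B) {p : ℤ → Prop}
    (hp : ∃ᶠ n in atTop, p n) :
    ∃ y : ℤ → ℤ, (∀ m, |y m| ≤ B) ∧
      ∀ N : ℕ, ∃ᶠ n in atTop, p n ∧ ∀ m : ℤ, |m| ≤ N → s (n + m) = y m := by
  have hne := frequently_iff_neBot.1 hp
  obtain ⟨y, hyB, hy⟩ := exists_ultrafilter_limit (Ultrafilter.of (atTop ⊓ 𝓟 {n | p n}))
    (s := fun n m => s (n + m)) fun n m => hB (n + m)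
  refine ⟨y, hyB, fun N => ?_⟩
  have hle := Ultrafilter.of_le (atTop ⊓ 𝓟 {n : ℤ | p n})
  have h1 : ∀ᶠ n in (Ultrafilter.of (atTop ⊓ 𝓟 {n : ℤ | p n}) : Filter ℤ), p n :=
    (hle.trans inf_le_right) (mem_principal_self _)
  exact ((h1.and (hy N)).frequently).filter_mono (hle.trans inf_le_left)

/-- The rounding error of `x_n(g)`. -/
def roundErr (P : ℤ[X]) (g : expandingRoots P → ℂ[X]) (n : ℤ) : ℝ :=
  round (recSeq P g n) - recSeq P g n

lemma abs_roundErr (P : ℤ[X]) (g : expandingRoots P → ℂ[X]) (n : ℤ) :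
    |roundErr P g n| = distInt (recSeq P g n) := abs_sub_comm _ _

lemma abs_roundErr_le (P : ℤ[X]) (g : expandingRoots P → ℂ[X]) (n : ℤ) :
    |roundErr P g n| ≤ 1 / 2 := by
  rw [abs_roundErr]; exact abs_sub_round _

/-- The rounding errors of `x(g)` are coded by an integer sequence, bounded in terms of `P` and `k`
only. -/
lemma exists_isCode_roundErr {P : ℤ[X]} (hP : Admissible P) (hmonic : P.Monic) (k : ℕ) :
    ∃ B : ℤ, ∀ g ∈ Xi P k, ∃ s : ℤ → ℤ, (∀ n, |s n| ≤ B) ∧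
      IsCode (P ^ (k + 1)) (roundErr P g) s := by
  refine ⟨∑ i ∈ Finset.range ((P ^ (k + 1)).natDegree + 1), |(P ^ (k + 1)).coeff i|,
    fun g hg => ?_⟩
  have hcode : IsCode (P ^ (k + 1)) (roundErr P g) fun n =>
      ∑ i ∈ Finset.range ((P ^ (k + 1)).natDegree + 1),
        (P ^ (k + 1)).coeff i * round (recSeq P g (n + i)) := by
    have h1 : (fun n => ((roundErr P g n : ℝ) : ℂ)) =
        (fun n => ((round (recSeq P g n) : ℤ) : ℂ)) - recSeqC P g := by
      funext n
      rw [Pi.sub_apply, ← ofReal_recSeq hg, roundErr]; push_cast; rfl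
    rw [IsCode, h1, map_sub, aeval_pow_recSeqC hP hmonic hg.1, sub_zero]
    funext n
    rw [aeval_shiftEnd_apply (Nat.lt_succ_self _)]
    push_cast; rfl
  refine ⟨_, fun n => ?_, hcode⟩
  have h2 := congrArg norm (congrFun hcode n)
  rw [aeval_shiftEnd_apply (Nat.lt_succ_self _), Complex.norm_intCast] at h2
  rw [← Int.cast_le (R := ℝ), Int.cast_abs, ← h2]
  push_cast
  refine (norm_sum_le _ _).trans (Finset.sum_le_sum fun i _ => ?_)
  rw [norm_mul, Complex.norm_intCast, Complex.norm_real, Real.norm_eq_abs]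
  have := abs_roundErr_le P g (n + i)
  exact mul_le_of_le_one_right (abs_nonneg _) (by linarith)

/-- Any integer `u` may replace the nearest one: `|e|` is already the distance from `e` to the
integers, and that distance is 1-Lipschitz. -/
lemma abs_distInt_sub_le {x e : ℝ} {u : ℤ} (he : |e| ≤ 1 / 2) :
    |distInt x - (|e|)| ≤ |(u - x) - e| := by
  have hup : distInt x ≤ |(u : ℝ) - x| := by
    rw [abs_sub_comm]; exact round_le x u
  have hlow : |e| ≤ |e + ((round x - u : ℤ) : ℝ)| := by
    rcases eq_or_ne (round x - u) 0 with h | h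
    · simp [h]
    · have h2 : (1 : ℝ) ≤ |((round x - u : ℤ) : ℝ)| := by exact_mod_cast Int.one_le_abs h
      have h3 := abs_sub_abs_le_abs_sub ((round x - u : ℤ) : ℝ) (-e)
      rw [abs_neg, sub_neg_eq_add, add_comm _ e] at h3
      linarith
  have h4 := abs_sub_abs_le_abs_sub ((u : ℝ) - x) e
  have h5 := abs_sub_abs_le_abs_sub (e + ((round x - u : ℤ) : ℝ)) (round x - x)
  have h6 : e + ((round x - u : ℤ) : ℝ) - (round x - x) = -((u - x) - e) := by push_cast; ring
  rw [h6, abs_neg, abs_sub_comm _ x] at h5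
  rw [abs_le]
  unfold distInt at *
  constructor <;> linarith

lemma isBoundedUnder_distInt (P : ℤ[X]) (g : expandingRoots P → ℂ[X]) :
    IsBoundedUnder (· ≤ ·) atTop fun n : ℤ => distInt (recSeq P g n) :=
  isBoundedUnder_of ⟨1 / 2, fun _ => abs_sub_round _⟩

lemma isCoboundedUnder_distInt (P : ℤ[X]) (g : expandingRoots P → ℂ[X]) :
    IsCoboundedUnder (· ≤ ·) atTop fun n : ℤ => distInt (recSeq P g n) :=
  (isBoundedUnder_of ⟨0, fun _ => abs_nonneg _⟩ :
    IsBoundedUnder (· ≥ ·) atTop fun n : ℤ => distInt (recSeq P g n)).isCoboundedUnder_le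

lemma lagrangeSpectrum_subset_Icc (P : ℤ[X]) (k : ℕ) :
    lagrangeSpectrum P k ⊆ Set.Icc 0 (1 / 2) := by
  rintro l ⟨g, -, rfl⟩
  exact ⟨le_limsup_of_frequently_le (Frequently.of_forall fun _ => abs_nonneg _)
      (isBoundedUnder_distInt P g),
    limsup_le_of_le (isCoboundedUnder_distInt P g) (Eventually.of_forall fun _ => abs_sub_round _)⟩

/-- A point of the closure of the spectrum is approximated by coded sequences containing longer and
longer central words of one common sequence `y` infinitely often. -/
lemma exists_common_word_of_mem_closure {P : ℤ[X]} (hP : Admissible P) (hmonic : P.Monic) {k : ℕ}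
    {l : ℝ} (hl : l ∈ closure (lagrangeSpectrum P k)) :
    ∃ B : ℤ, ∃ y : ℤ → ℤ, ∀ N : ℕ, ∃ e : ℤ → ℝ, ∃ s : ℤ → ℤ,
      (∀ n, |e n| ≤ 1 / 2) ∧ (∀ n, |s n| ≤ B) ∧ IsCode (P ^ (k + 1)) e s ∧
      (∃ᶠ n in atTop, l - 1 / (N + 1) ≤ |e n| ∧ ∀ m : ℤ, |m| ≤ N → s (n + m) = y m) ∧
      ∀ᶠ n in atTop, |e n| ≤ l + 1 / (N + 1) := by
  obtain ⟨B, hB⟩ := exists_isCode_roundErr hP hmonic k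
  have h1 : ∀ N : ℕ, ∃ e : ℤ → ℝ, ∃ s y : ℤ → ℤ,
      (∀ n, |e n| ≤ 1 / 2) ∧ (∀ n, |s n| ≤ B) ∧ IsCode (P ^ (k + 1)) e s ∧ (∀ m, |y m| ≤ B) ∧
      (∀ M : ℕ, ∃ᶠ n in atTop, l - 1 / (N + 1) ≤ |e n| ∧ ∀ m : ℤ, |m| ≤ M → s (n + m) = y m) ∧
      ∀ᶠ n in atTop, |e n| ≤ l + 1 / (N + 1) := by
    intro N
    obtain ⟨_, ⟨g, hg, rfl⟩, hd⟩ := Metric.mem_closure_iff.1 hl _ (Nat.one_div_pos_of_nat (n := N))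
    rw [Real.dist_eq, abs_lt] at hd
    obtain ⟨s, hs, hcode⟩ := hB g hg
    have hfreq : ∃ᶠ n in atTop, l - 1 / (N + 1) ≤ |roundErr P g n| := by
      simp only [abs_roundErr]
      exact (frequently_lt_of_lt_limsup (isCoboundedUnder_distInt P g)
        (by linarith)).mono fun _ h => le_of_lt h
    obtain ⟨y, hyB, hy⟩ := exists_word_limit hs hfreq
    refine ⟨roundErr P g, s, y, abs_roundErr_le P g, hs, hcode, hyB, hy, ?_⟩
    simp only [abs_roundErr]
    exact (eventually_lt_of_limsup_lt (b := l + 1 / (N + 1)) (by linarith)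
      (isBoundedUnder_distInt P g)).mono fun _ h => le_of_lt h
  choose e s y he hs hcode hyB hfreq hev using h1
  -- Each approximant has its own limit word; a second limit makes the word common to all.
  obtain ⟨Y, -, hY⟩ := exists_ultrafilter_limit (hyperfilter ℕ) hyB
  refine ⟨B, Y, fun N => ?_⟩
  have hN : ∀ᶠ K in (hyperfilter ℕ : Filter ℕ), N ≤ K :=
    Nat.hyperfilter_le_atTop (eventually_ge_atTop N)
  obtain ⟨K, hK, hNK⟩ := ((hY N).and hN).exists
  have hle : 1 / ((K : ℝ) + 1) ≤ 1 / (N + 1) := Nat.one_div_le_one_div hNK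
  refine ⟨e K, s K, he K, hs K, hcode K, ?_, (hev K).mono fun n hn => by linarith⟩
  exact (hfreq K N).mono fun n hn => ⟨by linarith [hn.1], fun m hm => by rw [hn.2 m hm, hK m hm]⟩

/-! ### Gluing the codes. -/

lemma exists_mem_segment {T : ℕ → ℤ} (hT0 : T 0 = 0) (hge : ∀ N : ℕ, (N : ℤ) ≤ T N) {n : ℤ}
    (hn : 0 ≤ n) : ∃ N : ℕ, T N ≤ n ∧ n < T (N + 1) := by
  have hex : ∃ N, n < T (N + 1) := ⟨n.toNat, by have := hge (n.toNat + 1); omega⟩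
  classical
  refine ⟨Nat.find hex, ?_, Nat.find_spec hex⟩
  rcases h : Nat.find hex with _ | N
  · rw [hT0]; exact hn
  · exact not_lt.1 (Nat.find_min hex (m := N) (by omega))

lemma natCast_le_of_add_le {T : ℕ → ℤ} (hT0 : T 0 = 0) (hT : ∀ N, T N + N + 1 ≤ T (N + 1))
    (N : ℕ) : (N : ℤ) ≤ T N := by
  induction N with
  | zero => simp [hT0]
  | succ N ih => have := hT N; push_cast; omega

/-- Gluing of sequences along common words around the points `T N`. -/
lemma exists_glued {s : ℕ → ℤ → ℤ} {y : ℤ → ℤ} {T : ℕ → ℤ} (hT0 : T 0 = 0)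
    (hT : ∀ N, T N + N + 1 ≤ T (N + 1)) (hs : ∀ N : ℕ, ∀ m : ℤ, |m| ≤ N → s N (T N + m) = y m)
    (hs' : ∀ N : ℕ, ∀ m : ℤ, |m| ≤ N → s N (T (N + 1) + m) = y m) {B : ℤ} (hB : ∀ N n, |s N n| ≤ B) :
    ∃ t : ℤ → ℤ, (∀ n < 0, t n = 0) ∧ (∀ n, |t n| ≤ B) ∧
      ∀ N : ℕ, ∀ n m : ℤ, T N ≤ n → n < T (N + 1) → |m| < N → t (n + m) = s N (n + m) := by
  have hmono : Monotone T := monotone_nat_of_le_succ fun N => by have := hT N; omega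
  have hge := natCast_le_of_add_le hT0 hT
  have hloc : ∀ n : ℤ, ∃ N : ℕ, 0 ≤ n → T N ≤ n ∧ n < T (N + 1) := by
    intro n
    by_cases hn : 0 ≤ n
    · obtain ⟨N, hN⟩ := exists_mem_segment hT0 hge hn
      exact ⟨N, fun _ => hN⟩
    · exact ⟨0, fun h => absurd h hn⟩
  choose ν hν using hloc
  have huniq : ∀ N n, T N ≤ n → n < T (N + 1) → ν n = N := by
    intro N n h1 h2
    obtain ⟨h3, h4⟩ := hν n (by have := hge N; omega)
    by_contra hne
    rcases Nat.lt_or_gt_of_ne hne with h | h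
    · have := hmono (Nat.succ_le_of_lt h); simp only [Nat.succ_eq_add_one] at this; omega
    · have := hmono (Nat.succ_le_of_lt h); simp only [Nat.succ_eq_add_one] at this; omega
  have ht : ∀ N n, T N ≤ n → n < T (N + 1) → (if 0 ≤ n then s (ν n) n else 0) = s N n := by
    intro N n h1 h2
    rw [if_pos (by have := hge N; omega), huniq N n h1 h2]
  refine ⟨fun n => if 0 ≤ n then s (ν n) n else 0, fun n hn => if_neg (by omega), fun n => ?_,
    fun N n m h1 h2 hm => ?_⟩
  · dsimp only
    split_ifs
    · exact hB _ _
    · rw [abs_zero]; exact (abs_nonneg _).trans (hB 0 0)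
  · rw [abs_lt] at hm
    dsimp only
    rcases lt_or_ge (n + m) (T N) with h | h
    · obtain ⟨M, rfl⟩ : ∃ M, N = M + 1 := ⟨N - 1, by omega⟩
      have h3 := hT M
      push_cast at hm
      rw [ht M _ (by omega) h]
      have h4 := hs (M + 1) (n + m - T (M + 1)) (by rw [abs_le]; push_cast; omega)
      have h5 := hs' M (n + m - T (M + 1)) (by rw [abs_le]; omega)
      rw [add_sub_cancel] at h4 h5
      rw [h4, h5]
    rcases lt_or_ge (n + m) (T (N + 1)) with h' | h'
    · exact ht N _ h h'
    · have h3 := hT (N + 1)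
      push_cast at h3
      rw [ht (N + 1) _ h' (by omega)]
      have h4 := hs (N + 1) (n + m - T (N + 1)) (by rw [abs_le]; push_cast; omega)
      have h5 := hs' N (n + m - T (N + 1)) (by rw [abs_le]; omega)
      rw [add_sub_cancel] at h4 h5
      rw [h4, h5]

lemma exists_glued_code {P : ℤ[X]} (hP : Admissible P) (hmonic : P.Monic) {k : ℕ}
    {l : ℝ} (hl : l ∈ closure (lagrangeSpectrum P k)) :
    ∃ B : ℤ, ∃ t : ℤ → ℤ, ∃ T : ℕ → ℤ, ∃ e : ℕ → ℤ → ℝ, ∃ s : ℕ → ℤ → ℤ,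
      (∀ n < 0, t n = 0) ∧ (∀ n, |t n| ≤ B) ∧ T 0 = 0 ∧ (∀ N, T N + N + 1 ≤ T (N + 1)) ∧
      (∀ N n, |e N n| ≤ 1 / 2) ∧ (∀ N, IsCode (P ^ (k + 1)) (e N) (s N)) ∧
      (∀ N n, T N ≤ n → |e N n| ≤ l + 1 / (N + 1)) ∧
      (∀ N, l - 1 / (N + 1) ≤ |e N (T N)|) ∧
      ∀ N : ℕ, ∀ n m : ℤ, T N ≤ n → n < T (N + 1) → |m| < N → t (n + m) = s N (n + m) := by
  obtain ⟨B, y, h⟩ := exists_common_word_of_mem_closure hP hmonic hl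
  choose e s he hs hcode hfreq hev using h
  choose c hc using fun N => eventually_atTop.1 (hev N)
  choose a ha ha' using fun N => frequently_atTop.1 (hfreq N) (c N)
  choose b hb hb' using fun N => frequently_atTop.1 (hfreq N) (a N + N + 1)
  -- The piece of the `N`-th code from `a N` to `b N`, both centres of a word of `y`, is moved to
  -- start at `T N`.
  let T : ℕ → ℤ := fun N => ∑ j ∈ Finset.range N, (b j - a j)
  have hT0 : T 0 = 0 := Finset.sum_range_zero _
  have hTs : ∀ N, T (N + 1) = T N + (b N - a N) := fun N => Finset.sum_range_succ _ _
  have hT : ∀ N, T N + N + 1 ≤ T (N + 1) := fun N => by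
    have := hTs N; have := hb N; omega
  obtain ⟨t, ht0, htB, ht⟩ := exists_glued (s := fun N n => s N (n + (a N - T N))) (y := y) hT0 hT
    (fun N m hm => by rw [← (ha' N).2 m hm]; congr 1; ring)
    (fun N m hm => by rw [← (hb' N).2 m hm, hTs]; congr 1; ring) fun N n => hs N _
  refine ⟨B, t, T, fun N n => e N (n + (a N - T N)), _, ht0, htB, hT0, hT, fun N n => he N _,
    fun N => (hcode N).translate _, fun N n hn => hc N _ (by have := ha N; omega), fun N => ?_, ht⟩
  beta_reduce
  rw [add_sub_cancel]
  exact (ha' N).1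

/-! ### Closedness of the spectrum. -/

theorem isClosed_lagrangeSpectrum {P : ℤ[X]} (hP : Admissible P) (hmonic : P.Monic)
    (hhyp : Hyperbolic P) (k : ℕ) : IsClosed (lagrangeSpectrum P k) := by
  refine isClosed_of_closure_subset fun l hl => ?_
  obtain ⟨B, t, T, e, s, ht0, htB, hT0, hT, he, hcode, hup, hlow, hts⟩ :=
    exists_glued_code hP hmonic hl
  obtain ⟨g, hg, u, ⟨C, hC⟩, hu⟩ := exists_mem_Xi_bounded_sub hP hmonic hhyp k ht0 htB
  have hge := natCast_le_of_add_le hT0 hT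
  have key : ∀ η : ℝ, 0 < η → ∃ N₀ : ℕ, ∀ N ≥ N₀, ∀ n, T N ≤ n → n < T (N + 1) →
      |distInt (recSeq P g n) - (|e N n|)| ≤ η := by
    intro η hη
    obtain ⟨R, θ, hθ, hR⟩ := exists_window_multiset ((k + 1) • P.aroots ℂ)
      (fun β hβ => hhyp β (Multiset.mem_of_mem_nsmul hβ)) (B := C + 1 / 2) hη
    -- For `N > R` the window around `n` lies in `n ≥ 0`, where `C` applies, and `t` agrees there
    -- with the `N`-th code, so the difference of errors is annihilated exactly.
    refine ⟨R + 1, fun N hN n h1 h2 => ?_⟩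
    refine (abs_distInt_sub_le (u := u n) (he N n)).trans ?_
    rw [← aeval_pow_eq_aeval_multiset hmonic] at hR
    have h3 := hR (fun m => (((u (m + n) - recSeq P g (m + n)) - e N (m + n) : ℝ) : ℂ)) ?_ ?_
    · simpa only [zero_add, Complex.norm_real, Real.norm_eq_abs] using h3
    · intro m hm
      rw [Complex.norm_real, Real.norm_eq_abs]
      rw [abs_le] at hm
      obtain ⟨i, hi⟩ := Int.eq_ofNat_of_zero_le (a := m + n) (by have := hge N; omega)
      rw [hi]
      exact (abs_sub _ _).trans (add_le_add (hC i) (he N _))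
    · intro m hm
      have h4 : IsCode (P ^ (k + 1)) (fun m => u m - recSeq P g m) t := hu
      have h5 : (fun m : ℤ => (((u (m + n) - recSeq P g (m + n)) - e N (m + n) : ℝ) : ℂ)) =
          (fun m : ℤ => ((u (m + n) - recSeq P g (m + n) : ℝ) : ℂ)) -
            fun m : ℤ => ((e N (m + n) : ℝ) : ℂ) := by
        funext m; rw [Pi.sub_apply]; push_cast; rfl
      have h6 := h4.translate n
      have h7 := (hcode N).translate n
      rw [IsCode] at h6 h7
      rw [h5, map_sub, h6, h7, Pi.sub_apply, add_comm m n, hts N n m h1 h2 (by omega), sub_self,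
        norm_zero]
      exact hθ.le
  have hsmall : ∀ η : ℝ, 0 < η → ∃ N₁ : ℕ, ∀ N ≥ N₁, 1 / ((N : ℝ) + 1) ≤ η := by
    intro η hη
    obtain ⟨N₁, h⟩ := exists_nat_one_div_lt hη
    exact ⟨N₁, fun N hN => (Nat.one_div_le_one_div hN).trans h.le⟩
  have hmono : Monotone T := monotone_nat_of_le_succ fun N => by have := hT N; omega
  refine ⟨g, hg, le_antisymm ?_ ?_⟩
  -- The lower bound is attained along the cuts `T N`; the upper bound holds on whole segments.
  · refine le_of_forall_pos_le_add fun η hη => ?_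
    obtain ⟨N₀, h₀⟩ := key (η / 2) (half_pos hη)
    obtain ⟨N₁, h₁⟩ := hsmall (η / 2) (half_pos hη)
    rw [← sub_le_iff_le_add]
    refine le_limsup_of_frequently_le (frequently_atTop.2 fun A => ?_) (isBoundedUnder_distInt P g)
    set N := max (max N₀ N₁) A.toNat
    refine ⟨T N, by have := hge N; omega, ?_⟩
    have h2 := abs_le.1 (h₀ N (by omega) (T N) le_rfl (by have := hT N; omega))
    have h3 := h₁ N (by omega)
    have h4 := hlow N
    linarith [h2.1]
  · refine le_of_forall_pos_le_add fun η hη => ?_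
    obtain ⟨N₀, h₀⟩ := key (η / 2) (half_pos hη)
    obtain ⟨N₁, h₁⟩ := hsmall (η / 2) (half_pos hη)
    refine limsup_le_of_le (isCoboundedUnder_distInt P g) (eventually_atTop.2 ⟨T (max N₀ N₁), ?_⟩)
    intro n hn
    obtain ⟨N, hn1, hn2⟩ := exists_mem_segment hT0 hge (n := n)
      (by have := hge (max N₀ N₁); omega)
    have hN : max N₀ N₁ ≤ N := by
      by_contra hlt
      have := hmono (Nat.succ_le_of_lt (not_le.1 hlt))
      simp only [Nat.succ_eq_add_one] at this
      omega
    have h2 := abs_le.1 (h₀ N (by omega) n hn1 hn2)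
    have h3 := h₁ N (by omega)
    have h4 := hup N n hn1
    linarith [h2.2]

end

end MarkoffSpectrum

/-- For an admissible, monic and hyperbolic integer polynomial, all the spectra are closed
subsets of `[0, 1/2]`. -/
theorem theorem4p1 (P : Polynomial ℤ) (hP : MarkoffSpectrum.Admissible P)
    (hmonic : P.Monic) (hhyp : MarkoffSpectrum.Hyperbolic P) (k : ℕ) :
    MarkoffSpectrum.lagrangeSpectrum P k ⊆ Set.Icc 0 (1 / 2) ∧
      IsClosed (MarkoffSpectrum.lagrangeSpectrum P k) := by
  exact ⟨MarkoffSpectrum.lagrangeSpectrum_subset_Icc P k,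
    MarkoffSpectrum.isClosed_lagrangeSpectrum hP hmonic hhyp k⟩
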